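/- Fix $k\in\mathbb{N}$. Let $r([k])$ be the set of nonempty subsets of $[k]=\{1,\dots,k\}$, for $S\in r([k])$ let $r(S)$ be the set of nonempty subsets of $S$, and let $X=[0,1]^{r([k])}$ with Lebesgue measure $\lambda$. A permutation $\sigma\in S_k$ induces a permutation of $r([k])$ and hence a change of coordinates $\tilde\sigma:X\to X$. For $S\in r([k])$ let $\mathcal{A}_S$ be the $\sigma$-algebra on $X$ that is the pull-back of the Borel $\sigma$-algebra of $[0,1]^{r(S)}$ under the coordinate projection $\pi_S:X\to[0,1]^{r(S)}$, and let $\mathcal{A}^*_S$ be the $\sigma$-algebra generated by $\bigcup\mathcal{A}_T$ over all nonempty proper subsets $T\subsetneq S$. Let $H$ be the group of measure-preserving bijections of $(X,\lambda)$ (bijections, measurable in both directions), two of them being identified if they agree almost everywhere, with the weak topology, generated by the sets $\{h\in H:\lambda(gA\triangle hA)<\varepsilon\}$ with $g\in H$, $A\subseteq X$ measurable and $\varepsilon>0$. A map $\psi:X\to X$ is structure preserving if (1) $\psi$ is measure preserving; (2) for every $\sigma\in S_k$, $\tilde\sigma\psi=\psi\tilde\sigma$ almost everywhere; (3) for every $S\in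 r([k])$ and $A\in\mathcal{A}_S$, the set $\psi^{-1}(A)$ agrees up to a null set with a member of $\mathcal{A}_S$; (4) for every $S\in r([k])$ and every measurable $A\subseteq[0,1]$, the set $\psi^{-1}(\{x\in X: x(S)\in A\})$ is independent of $\mathcal{A}^*_S$. Let $G\subseteq H$ be the set of classes of structure-preserving measure-preserving bijections. A $k$-uniform hypergraphon is a measurable set $W\subseteq X$ with $\tilde\sigma^{-1}(W)=W$ for all $\sigma\in S_k$. Let $\mathcal{W}^k_0$ be the set of all $k$-uniform hypergraphons, two of them being identified if they differ by a null set, with the metric $d_1(U,W)=\|1_U-1_W\|_1=\lambda(U\triangle W)$. **Proposition.** $G$ is a closed subgroup of $H$. Moreover, there is a natural action of $G$ on $\mathcal{W}^k_0$, in which $gW$ is the class of $\{x\in X: g^{-1}(x)\in W\}$ (that is, the hypergraphons in this class are exactly those that agree with this set up to a null set), and this action is continuous as a map $G\times(\mathcal{W}^k_0,d_1)\to(\mathcal{W}^k_0,d_1)$. -/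

import Mathlib

open MeasureTheory Set Filter Topology
open scoped unitInterval ENNReal

noncomputable section

namespace KHypergraphon

/-! ## Measure preserving bijections modulo null sets, and the weak topology -/

section Aut

/-- Measure preserving bijections of a measure space: bijections, measurable in both directions,
that preserve the measure. -/
abbrev MPBij (Ω : Type) [MeasureSpace Ω] : Type :=
  {e : Ω ≃ᵐ Ω // MeasurePreserving (e : Ω → Ω) volume volume}

variable {Ω : Type} [MeasureSpace Ω]

/-- Measure preserving bijections form a group under composition: `(g * h) x = g (h x)`. -/
instance : Group (MPBij Ω) where
  mul g h := ⟨h.1.trans g.1, g.2.comp h.2⟩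
  one := ⟨MeasurableEquiv.refl Ω, MeasurePreserving.id _⟩
  inv g := ⟨g.1.symm, MeasurePreserving.symm g.1 g.2⟩
  mul_assoc _ _ _ := rfl
  one_mul _ := rfl
  mul_one _ := rfl
  inv_mul_cancel g := Subtype.ext (MeasurableEquiv.ext (funext fun x => g.1.symm_apply_apply x))

variable (Ω) in
/-- Equality almost everywhere, as a congruence on the group of measure preserving bijections. -/
def aeCon : Con (MPBij Ω) where
  r g h := (g.1 : Ω → Ω) =ᵐ[volume] (h.1 : Ω → Ω)
  iseqv := ⟨fun _ => EventuallyEq.rfl, fun h => h.symm, fun h₁ h₂ => h₁.trans h₂⟩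
  mul' := by
    intro g g' h h' hg hh
    have h1 : ∀ᵐ x, g.1 (h.1 x) = g'.1 (h.1 x) := h.2.quasiMeasurePreserving.ae hg
    filter_upwards [h1, hh] with x hx hx'
    change g.1 (h.1 x) = g'.1 (h'.1 x)
    rw [hx, hx']

variable (Ω) in
/-- The group of measure preserving bijections, where bijections that agree almost everywhere
are identified. -/
abbrev MPAut : Type := (aeCon Ω).Quotient

/-- The class of a measure preserving bijection. -/
abbrev MPAut.mk (g : MPBij Ω) : MPAut Ω := (g : (aeCon Ω).Quotient)

theorem image_ae_eq {g g' : MPBij Ω} (h : (g.1 : Ω → Ω) =ᵐ[volume] (g'.1 : Ω → Ω))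
    (A : Set Ω) : (g.1 '' A : Set Ω) =ᵐ[volume] (g'.1 '' A : Set Ω) := by
  have h1 : ∀ᵐ y, g.1 (g.1.symm y) = g'.1 (g.1.symm y) :=
    (MeasurePreserving.symm g.1 g.2).quasiMeasurePreserving.ae h
  refine eventuallyEq_set.2 ?_
  filter_upwards [h1] with y hy
  rw [MeasurableEquiv.apply_symm_apply] at hy
  have h2 : g'.1.symm y = g.1.symm y := by
    rw [MeasurableEquiv.symm_apply_eq]; exact hy
  rw [MeasurableEquiv.image_eq_preimage_symm, MeasurableEquiv.image_eq_preimage_symm,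
    mem_preimage, mem_preimage, h2]

/-- `λ(gA △ hA)`, which depends only on the classes of `g` and `h`. -/
def weakDist (A : Set Ω) (g h : MPAut Ω) : ℝ≥0∞ :=
  Con.liftOn₂ g h (fun g h => volume (symmDiff (g.1 '' A) (h.1 '' A))) (by
    intro g h g' h' hg hh
    exact measure_congr ((image_ae_eq hg A).symmDiff (image_ae_eq hh A)))

/-- The weak topology, generated by the sets `{h | λ(gA △ hA) < ε}` with `A` measurable and
`ε > 0`. -/
instance : TopologicalSpace (MPAut Ω) :=
  TopologicalSpace.generateFrom
    {U | ∃ (g : MPAut Ω) (A : Set Ω) (ε : ℝ≥0∞),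
      MeasurableSet A ∧ 0 < ε ∧ U = {h | weakDist A g h < ε}}

end Aut

/-! ## The cube, its coordinate permutations and its σ-algebras -/

/-- The set `r([k])` of nonempty subsets of `[k]`. -/
abbrev Idx (k : ℕ) : Type := {S : Finset (Fin k) // S.Nonempty}

/-- The cube `[0,1]^{r([k])}`; its `volume` is Lebesgue (product) measure. -/
abbrev Cube (k : ℕ) : Type := Idx k → I

/-- The permutation of `r([k])` induced by a permutation of `[k]`. -/
def permIdx {k : ℕ} (τ : Equiv.Perm (Fin k)) (S : Idx k) : Idx k :=
  ⟨S.1.map τ.toEmbedding, S.2.map⟩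

/-- The change of coordinates of the cube induced by a permutation of `[k]`. -/
def permCube {k : ℕ} (τ : Equiv.Perm (Fin k)) (x : Cube k) : Cube k :=
  fun S => x (permIdx τ S)

/-- The projection `[0,1]^{r([k])} → [0,1]^{r(S)}`, where `r(S)` consists of the nonempty subsets
of `S`. -/
def proj {k : ℕ} (S : Idx k) (x : Cube k) : {T : Idx k // T.1 ⊆ S.1} → I :=
  fun T => x T.1

/-- The σ-algebra `𝒜_S`: the pull-back along `proj S`. -/
abbrev sigmaAlg {k : ℕ} (S : Idx k) : MeasurableSpace (Cube k) :=
  MeasurableSpace.comap (proj S) inferInstance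

/-- The σ-algebra `𝒜*_S`, generated by the `𝒜_T` with `T` a proper (nonempty) subset of `S`. -/
abbrev sigmaAlgStar {k : ℕ} (S : Idx k) : MeasurableSpace (Cube k) :=
  ⨆ (T : Idx k) (_ : T.1 ⊂ S.1), sigmaAlg T

/-- Structure preserving maps of the cube; all conditions are understood modulo null sets. -/
structure StructurePreserving {k : ℕ} (ψ : Cube k → Cube k) : Prop where
  measurePreserving : MeasurePreserving ψ volume volume
  comm : ∀ τ : Equiv.Perm (Fin k), ∀ᵐ x, permCube τ (ψ x) = ψ (permCube τ x)
  preimage_mem : ∀ (S : Idx k) (A : Set (Cube k)), MeasurableSet[sigmaAlg S] A →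
    ∃ B : Set (Cube k), MeasurableSet[sigmaAlg S] B ∧ (ψ ⁻¹' A : Set (Cube k)) =ᵐ[volume] B
  indep : ∀ (S : Idx k) (A : Set I), MeasurableSet A →
    ProbabilityTheory.IndepSets {ψ ⁻¹' {x | x S ∈ A}} {B | MeasurableSet[sigmaAlgStar S] B} volume

/-! ## Hypergraphons -/

/-- A `k`-uniform hypergraphon: a measurable subset of the cube that is invariant under the
changes of coordinates induced by permutations of `[k]`. -/
structure Hypergraphon (k : ℕ) where
  carrier : Set (Cube k)
  measurableSet : MeasurableSet carrier
  symmetric : ∀ τ : Equiv.Perm (Fin k), permCube τ ⁻¹' carrier = carrier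

/-- The distance `d₁(U, W) = ‖1_U - 1_W‖₁`. -/
instance (k : ℕ) : PseudoMetricSpace (Hypergraphon k) :=
  PseudoMetricSpace.induced
    (fun W => indicatorConstLp 1 W.measurableSet (measure_ne_top volume W.carrier) (1 : ℝ))
    inferInstance

/-- The metric space `(𝒲₀ᵏ, d₁)`: hypergraphons at `d₁`-distance `0` (that is, hypergraphons that
differ by a null set) are identified. -/
abbrev HypergraphonSpace (k : ℕ) : Type := SeparationQuotient (Hypergraphon k)

end KHypergraphon

end

/-! The hard point is that an inverse still satisfies (3): `g` pulls `𝒜_T` into itself modulo null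
sets, and this inclusion must be an equality. By (3) and (4), the `U`-coordinate of `g` is
independent of all coordinates other than `U`. Adding indices in order of size, the coordinates of
`g` outside `r(T)` are jointly independent of `𝒜_T` (`StructurePreserving.indep_compl`). Since `g`
is a bijection, these coordinates and `g⁻¹(𝒜_T)` generate everything. An event of `𝒜_T` then equals
its conditional expectation on `g⁻¹(𝒜_T)`, so it lies there modulo null sets
(`measurableSet_aeAlg_of_indep`). Stability under inverses and products follows.

For closedness, the weak topology controls images `gA`, that is, preimages under `g⁻¹`. Each
condition on `g⁻¹` survives approximation in measure, and inverting once more gives the condition on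
`g`.

For the action, `gW` is invariant only almost everywhere, so it is symmetrized on a null set. Joint
continuity is the estimate `d₁(hV, gW) ≤ d₁(V, W) + λ(gW △ hW)`. -/

namespace KHypergraphon

open ProbabilityTheory

/-! ### Independence and σ-algebras modulo null sets -/

section General

variable {Ω : Type*} {m m₁ m₂ m₃ m0 : MeasurableSpace Ω} {μ : Measure Ω}

/-- The σ-algebra of sets that agree up to a null set with a member of `m`. -/
abbrev aeAlg (m : MeasurableSpace Ω) {m0 : MeasurableSpace Ω} (μ : Measure Ω) :
    MeasurableSpace Ω :=
  eventuallyMeasurableSpace m (ae μ)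

/-- Intersections of members of two σ-algebras. -/
def interSets (m₁ m₂ : MeasurableSpace Ω) : Set (Set Ω) :=
  {E | ∃ B C, MeasurableSet[m₁] B ∧ MeasurableSet[m₂] C ∧ E = B ∩ C}

theorem isPiSystem_interSets (m₁ m₂ : MeasurableSpace Ω) : IsPiSystem (interSets m₁ m₂) := by
  rintro _ ⟨B, C, hB, hC, rfl⟩ _ ⟨B', C', hB', hC', rfl⟩ -
  exact ⟨B ∩ B', C ∩ C', hB.inter hB', hC.inter hC', inter_inter_inter_comm _ _ _ _⟩

theorem generateFrom_interSets (m₁ m₂ : MeasurableSpace Ω) :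
    m₁ ⊔ m₂ = MeasurableSpace.generateFrom (interSets m₁ m₂) := by
  apply le_antisymm
  · refine sup_le (fun B hB => ?_) (fun C hC => ?_)
    · exact MeasurableSpace.measurableSet_generateFrom
        ⟨B, univ, hB, MeasurableSet.univ, (inter_univ B).symm⟩
    · exact MeasurableSpace.measurableSet_generateFrom
        ⟨univ, C, MeasurableSet.univ, hC, (univ_inter C).symm⟩
  · refine MeasurableSpace.generateFrom_le ?_
    rintro _ ⟨B, C, hB, hC, rfl⟩
    exact ((le_sup_left : m₁ ≤ m₁ ⊔ m₂) _ hB).inter ((le_sup_right : m₂ ≤ m₁ ⊔ m₂) _ hC)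

theorem indep_sup [IsProbabilityMeasure μ]
    (h₁ : m₁ ≤ m0) (h₂ : m₂ ≤ m0) (h₃ : m₃ ≤ m0)
    (h : ∀ B C D, MeasurableSet[m₁] B → MeasurableSet[m₂] C → MeasurableSet[m₃] D →
      μ (B ∩ C ∩ D) = μ (B ∩ C) * μ D) :
    Indep (m₁ ⊔ m₂) m₃ μ := by
  refine IndepSets.indep (sup_le h₁ h₂) h₃ (isPiSystem_interSets m₁ m₂)
    (@MeasurableSpace.isPiSystem_measurableSet _ m₃) (generateFrom_interSets m₁ m₂)
    (@MeasurableSpace.generateFrom_measurableSet _ m₃).symm ?_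
  rw [IndepSets_iff]
  rintro _ D ⟨B, C, hB, hC, rfl⟩ hD
  exact h B C D hB hC hD

theorem indep_aeAlg (h : Indep m₁ m₂ μ) :
    Indep (aeAlg m₁ μ) (aeAlg m₂ μ) μ := by
  rw [Indep_iff] at h ⊢
  rintro A B ⟨A', hA', hA⟩ ⟨B', hB', hB⟩
  rw [measure_congr (hA.inter hB), measure_congr hA, measure_congr hB, h A' B' hA' hB']

theorem measure_inter_of_indep {A B : Set Ω} (h : Indep m₁ m₂ μ)
    (hA : MeasurableSet[aeAlg m₁ μ] A) (hB : MeasurableSet[aeAlg m₂ μ] B) :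
    μ (A ∩ B) = μ A * μ B :=
  (Indep_iff _ _ _).1 (indep_aeAlg h) A B hA hB

theorem inter_mem_aeAlg {A B : Set Ω} (hA : MeasurableSet[aeAlg m μ] A)
    (hB : MeasurableSet[aeAlg m μ] B) : MeasurableSet[aeAlg m μ] (A ∩ B) :=
  @MeasurableSet.inter _ (aeAlg m μ) A B hA hB

theorem mem_aeAlg {A : Set Ω} (hA : MeasurableSet[m] A) : MeasurableSet[aeAlg m μ] A :=
  ⟨A, hA, ae_eq_refl A⟩

/-- If `m₁` and `m₂` are independent and generate the full σ-algebra, and `C` is independent of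
`D` relative to `m₁` for every `C` in `m₂`, then `D` belongs to `m₁` up to a null set. -/
theorem measurableSet_aeAlg_of_indep [IsProbabilityMeasure μ]
    (hsup : m₁ ⊔ m₂ = m0) (hind : Indep m₁ m₂ μ) {D : Set Ω} (hD : MeasurableSet D)
    (h : ∀ B C, MeasurableSet[m₁] B → MeasurableSet[m₂] C →
      μ (D ∩ B ∩ C) = μ (D ∩ B) * μ C) :
    MeasurableSet[aeAlg m₁ μ] D := by
  have h₁ : m₁ ≤ m0 := hsup ▸ le_sup_left
  have h₂ : m₂ ≤ m0 := hsup ▸ le_sup_right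
  set f : Ω → ℝ := D.indicator 1 with hf
  have hfi : Integrable f μ := (integrable_const (1 : ℝ)).indicator hD
  set p : Ω → ℝ := μ[f|m₁] with hp
  have hpi : Integrable p μ := integrable_condExp
  -- On `B ∩ C`, `p` is `m₁`-measurable, hence independent of `C`, so its integral factors exactly
  -- as `h` says that of `1_D` does. Such intersections form a generating π-system.
  have key : ∀ E, MeasurableSet E → ∫ x in E, p x ∂μ = ∫ x in E, f x ∂μ := by
    refine MeasurableSpace.induction_on_inter
      (C := fun E _ => ∫ x in E, p x ∂μ = ∫ x in E, f x ∂μ)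
      (hsup.symm.trans (generateFrom_interSets m₁ m₂)) (isPiSystem_interSets m₁ m₂)
      (by simp) ?_ ?_ ?_
    · rintro _ ⟨B, C, hB, hC, rfl⟩
      have e1 : ∫ x in B ∩ C, f x ∂μ = μ.real (D ∩ B ∩ C) := by
        rw [hf, integral_indicator_one hD, measureReal_restrict_apply hD, inter_assoc]
      have e2 : ∫ x in B, p x ∂μ = μ.real (D ∩ B) := by
        rw [hp, setIntegral_condExp h₁ hfi hB, hf, integral_indicator_one hD,
          measureReal_restrict_apply hD]
      have hI : IndepFun (B.indicator p) (C.indicator (1 : Ω → ℝ)) μ := by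
        rw [IndepFun_iff_Indep]
        refine indep_of_indep_of_le_left (indep_of_indep_of_le_right hind ?_) ?_
        · exact Measurable.comap_le
            (((@measurable_const _ _ _ m₂ (1 : ℝ)).indicator hC))
        · exact Measurable.comap_le
            ((stronglyMeasurable_condExp (m := m₁)).measurable.indicator hB)
      have e3 : ∫ x in B ∩ C, p x ∂μ = μ.real (D ∩ B) * μ.real C := by
        have := hI.integral_fun_mul_eq_mul_integral
          (hpi.indicator (h₁ _ hB)).aestronglyMeasurable
          ((integrable_const (1 : ℝ)).indicator (h₂ _ hC)).aestronglyMeasurable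
        rw [integral_indicator (h₁ _ hB), e2, integral_indicator_one (h₂ _ hC)] at this
        rw [← this, ← integral_indicator ((h₁ _ hB).inter (h₂ _ hC))]
        congr 1
        ext x
        by_cases hxB : x ∈ B <;> by_cases hxC : x ∈ C <;> simp [hxB, hxC]
      rw [e1, e3, measureReal_def, measureReal_def, measureReal_def, h B C hB hC,
        ENNReal.toReal_mul]
    · intro E hE hEq
      have a := integral_add_compl hE hpi
      have b := integral_add_compl hE hfi
      have c : ∫ x, p x ∂μ = ∫ x, f x ∂μ := integral_condExp h₁
      linarith
    · intro E hdisj hE hEq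
      rw [integral_iUnion hE hdisj hpi.integrableOn, integral_iUnion hE hdisj hfi.integrableOn]
      exact tsum_congr hEq
  have hae : p =ᵐ[μ] f := Integrable.ae_eq_of_forall_setIntegral_eq p f hpi hfi
    fun E hE _ => key E hE
  refine ⟨p ⁻¹' {1}, (stronglyMeasurable_condExp (m := m₁)).measurable
    (measurableSet_singleton 1), ?_⟩
  refine eventuallyEq_set.2 ?_
  filter_upwards [hae] with x hx
  rw [mem_preimage, hx, hf, mem_singleton_iff]
  by_cases hxD : x ∈ D <;> simp [hxD]

/-- The sets that agree up to a null set with a member of `m` are closed in measure. -/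
theorem measurableSet_aeAlg_of_forall_lt {A : Set Ω}
    (h : ∀ ε : ℝ≥0∞, 0 < ε → ∃ B, MeasurableSet[aeAlg m μ] B ∧ μ (symmDiff A B) < ε) :
    MeasurableSet[aeAlg m μ] A := by
  -- Borel–Cantelli: with summable errors, almost every point lies in only finitely many `A △ B n`,
  -- so `A` agrees with the limsup of the `B n`.
  obtain ⟨ε, hε, hsum⟩ := ENNReal.exists_pos_sum_of_countable one_ne_zero ℕ
  choose B hB hlt using fun n => h (ε n) (by exact_mod_cast hε n)
  have hfin : ∑' n, μ (symmDiff A (B n)) ≠ ∞ :=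
    ne_top_of_lt ((ENNReal.tsum_le_tsum fun n => (hlt n).le).trans_lt hsum)
  refine EventuallyMeasurableSet.congr (t := limsup B atTop)
    (@MeasurableSet.measurableSet_limsup _ (aeAlg m μ) B hB) (eventuallyEq_set.2 ?_)
  filter_upwards [ae_eventually_notMem hfin] with x hx
  have hx' : ∀ᶠ n in atTop, (x ∈ A ↔ x ∈ B n) := hx.mono fun n hn => by
    rw [mem_symmDiff] at hn; tauto
  rw [mem_limsup_iff_frequently_mem]
  constructor
  · exact fun hA => (hx'.mono fun n hn => hn.1 hA).frequently
  · intro hf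
    obtain ⟨n, hn, hn'⟩ := (hf.and_eventually hx').exists
    exact hn'.2 hn

end General

/-! ### Coordinate σ-algebras -/

section Coord

variable {k : ℕ}

/-- The σ-algebra on the cube generated by the coordinates in `s`. -/
abbrev coordAlg (s : Set (Idx k)) : MeasurableSpace (Cube k) :=
  ⨆ V ∈ s, MeasurableSpace.comap (fun x : Cube k => x V) inferInstance

theorem coordAlg_mono {s t : Set (Idx k)} (h : s ⊆ t) : coordAlg s ≤ coordAlg t :=
  biSup_mono h

theorem coordAlg_union (s t : Set (Idx k)) : coordAlg (s ∪ t) = coordAlg s ⊔ coordAlg t :=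
  iSup_union

theorem coordAlg_singleton (V : Idx k) :
    coordAlg {V} = MeasurableSpace.comap (fun x : Cube k => x V) inferInstance := by
  simp [coordAlg]

theorem coordAlg_empty : coordAlg (∅ : Set (Idx k)) = ⊥ := by
  simp [coordAlg]

theorem coordAlg_univ : coordAlg (univ : Set (Idx k)) = MeasurableSpace.pi := by
  simp [coordAlg, MeasurableSpace.pi]

theorem coordAlg_le (s : Set (Idx k)) : coordAlg s ≤ MeasurableSpace.pi :=
  (coordAlg_mono (subset_univ s)).trans_eq coordAlg_univ

theorem indep_coordAlg {s t : Set (Idx k)} (h : Disjoint s t) :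
    Indep (coordAlg s) (coordAlg t) volume := by
  refine indep_iSup_of_disjoint (fun V => (measurable_pi_apply V).comap_le) ?_ h
  rw [← iIndepFun_iff_iIndep (β := fun _ => I)]
  exact iIndepFun_pi (X := fun _ => id) fun _ => aemeasurable_id

theorem sigmaAlg_eq (S : Idx k) : sigmaAlg S = coordAlg {T | T.1 ⊆ S.1} := by
  rw [sigmaAlg, coordAlg, MeasurableSpace.pi, MeasurableSpace.comap_iSup, iSup_subtype]
  simp only [MeasurableSpace.comap_comp]
  rfl

theorem sigmaAlg_le (S : Idx k) : sigmaAlg S ≤ MeasurableSpace.pi :=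
  sigmaAlg_eq S ▸ coordAlg_le _

theorem sigmaAlgStar_eq (S : Idx k) : sigmaAlgStar S = coordAlg {T | T.1 ⊂ S.1} := by
  simp only [sigmaAlgStar, sigmaAlg_eq]
  apply le_antisymm
  · exact iSup₂_le fun T hT => coordAlg_mono fun U hU => lt_of_le_of_lt hU hT
  · refine iSup₂_le fun T hT => le_iSup₂_of_le T hT ?_
    rw [← coordAlg_singleton]
    exact coordAlg_mono (singleton_subset_iff.2 (subset_refl T.1))

theorem indep_coord_sigmaAlgStar (S : Idx k) :
    Indep (coordAlg {S}) (sigmaAlgStar S) volume := by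
  rw [sigmaAlgStar_eq]
  refine indep_coordAlg (disjoint_singleton_left.2 fun h => ?_)
  exact ssubset_irrefl S.1 h

theorem measurableSet_coordAlg_coord (S : Idx k) {A : Set I} (hA : MeasurableSet A) :
    MeasurableSet[coordAlg {S}] {x : Cube k | x S ∈ A} := by
  rw [coordAlg_singleton]
  exact ⟨A, hA, rfl⟩

theorem sigmaAlgStar_le (S : Idx k) : sigmaAlgStar S ≤ MeasurableSpace.pi :=
  sigmaAlgStar_eq S ▸ coordAlg_le _

theorem measurableSet_sigmaAlg_coord (S : Idx k) {A : Set I} (hA : MeasurableSet A) :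
    MeasurableSet[sigmaAlg S] {x : Cube k | x S ∈ A} :=
  ⟨{y | y ⟨S, subset_refl _⟩ ∈ A}, measurable_pi_apply _ hA, rfl⟩

/-! ### Coordinates of a structure-preserving map -/

theorem StructurePreserving.preimage_coord {ψ : Cube k → Cube k} (hψ : StructurePreserving ψ)
    {s t : Set (Idx k)} (hst : ∀ U ∈ s, ∀ V : Idx k, V.1 ⊆ U.1 → V ∈ t) :
    (coordAlg s).comap ψ ≤ aeAlg (coordAlg t) volume := by
  simp only [coordAlg, MeasurableSpace.comap_iSup]
  refine iSup₂_le fun U hU => ?_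
  rintro _ ⟨_, ⟨A, hA, rfl⟩, rfl⟩
  obtain ⟨B, hB, hAB⟩ := hψ.preimage_mem U _ (measurableSet_sigmaAlg_coord U hA)
  refine ⟨B, ?_, hAB⟩
  rw [sigmaAlg_eq] at hB
  exact coordAlg_mono (fun V hV => hst U hU V hV) _ hB

/-- Condition (4) gives independence only from the proper subsets of `U`. By (3) the `U`-coordinate
of `ψ` depends only on `r(U)`, so the coordinates outside `r(U)` can be adjoined by the product
structure of the measure. -/
theorem StructurePreserving.indep_coord {ψ : Cube k → Cube k} (hψ : StructurePreserving ψ)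
    (U : Idx k) :
    Indep (coordAlg {U}ᶜ) ((coordAlg {U}).comap ψ) volume := by
  have hU : ({U}ᶜ : Set (Idx k)) = {V | V.1 ⊂ U.1} ∪ {V | V.1 ⊆ U.1}ᶜ := by
    ext V
    simp only [mem_compl_iff, mem_singleton_iff, mem_union, mem_ofPred_eq, ssubset_iff_subset_ne,
      ne_eq, Subtype.ext_iff]
    by_cases h : V.1 = U.1
    · simp [h]
    · tauto
  have hle : (coordAlg {U}).comap ψ ≤ aeAlg (coordAlg {V : Idx k | V.1 ⊆ U.1}) volume :=
    hψ.preimage_coord fun V hV W hW => by rw [mem_singleton_iff.1 hV] at hW; exact hW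
  rw [hU, coordAlg_union]
  refine indep_sup (coordAlg_le _) (coordAlg_le _)
    ((MeasurableSpace.comap_mono (coordAlg_le _)).trans
      hψ.measurePreserving.measurable.comap_le) ?_
  intro B C D hB hC hD
  have i1 : Indep (coordAlg {V : Idx k | V.1 ⊆ U.1}) (coordAlg {V : Idx k | V.1 ⊆ U.1}ᶜ) volume :=
    indep_coordAlg disjoint_compl_right
  have hB' : MeasurableSet[aeAlg (coordAlg {V : Idx k | V.1 ⊆ U.1}) volume] B :=
    mem_aeAlg (coordAlg_mono (fun V (hV : V.1 ⊂ U.1) => hV.subset) _ hB)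
  have i2 : volume (B ∩ D) = volume B * volume D := by
    rw [coordAlg_singleton] at hD
    obtain ⟨_, ⟨A, hA, rfl⟩, rfl⟩ := hD
    rw [inter_comm, mul_comm]
    exact (IndepSets_iff _ _ _).1 (hψ.indep U A hA) _ B rfl (by rw [sigmaAlgStar_eq]; exact hB)
  rw [inter_right_comm, measure_inter_of_indep i1 (inter_mem_aeAlg hB' (hle D hD)) (mem_aeAlg hC),
    measure_inter_of_indep i1 hB' (mem_aeAlg hC), i2]
  ring

/-- The coordinates of `ψ` outside `r(T)` are jointly independent of `𝒜_T`. -/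
theorem StructurePreserving.indep_compl {ψ : Cube k → Cube k} (hψ : StructurePreserving ψ)
    (T : Idx k) :
    Indep ((coordAlg {U : Idx k | U.1 ⊆ T.1}ᶜ).comap ψ) (sigmaAlg T) volume := by
  classical
  suffices H : ∀ F : Finset (Idx k), (∀ U ∈ F, ¬ U.1 ⊆ T.1) →
      Indep ((coordAlg (F : Set (Idx k))).comap ψ) (sigmaAlg T) volume by
    have := H {U : Idx k | U.1 ⊆ T.1}ᶜ.toFinset (fun U hU => by simpa using hU)
    rwa [coe_toFinset] at this
  intro F
  -- The index `U` added last has maximal cardinality, so it lies in no earlier `V ∈ F`. The earlier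
  -- coordinates of `ψ`, and also `𝒜_T`, therefore do not involve the coordinate `U`, and
  -- `indep_coord` splits off the new factor.
  induction F using Finset.induction_on_max_value (fun U : Idx k => U.1.card) with
  | empty =>
    intro _
    rw [Finset.coe_empty, coordAlg_empty, MeasurableSpace.comap_bot]
    exact indep_bot_left _
  | insert U F hUF hmax ih =>
    intro hF
    have hUT : ¬ U.1 ⊆ T.1 := hF U (Finset.mem_insert_self _ _)
    have ih' := ih fun V hV => hF V (Finset.mem_insert_of_mem hV)
    have hm : ∀ s : Set (Idx k), (coordAlg s).comap ψ ≤ MeasurableSpace.pi := fun s =>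
      (MeasurableSpace.comap_mono (coordAlg_le s)).trans
        hψ.measurePreserving.measurable.comap_le
    rw [Finset.coe_insert, insert_eq, coordAlg_union, MeasurableSpace.comap_sup]
    refine indep_sup (hm _) (hm _) (sigmaAlg_le T) ?_
    intro B C D hB hC hD
    have hU := hψ.indep_coord U
    have hB' : MeasurableSet[aeAlg ((coordAlg {U}).comap ψ) volume] B := mem_aeAlg hB
    have hC' : MeasurableSet[aeAlg (coordAlg {U}ᶜ) volume] C := by
      have hF : ∀ V ∈ (F : Set (Idx k)), ∀ W : Idx k, W.1 ⊆ V.1 → W ∈ ({U}ᶜ : Set (Idx k)) := by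
        intro V hV W hWV
        rw [mem_compl_singleton_iff]
        rintro rfl
        have : W = V := Subtype.ext (Finset.eq_of_subset_of_card_le hWV (hmax V hV))
        exact hUF (by rwa [this])
      exact hψ.preimage_coord hF C hC
    have hD' : MeasurableSet[aeAlg (coordAlg {U}ᶜ) volume] D := by
      rw [sigmaAlg_eq] at hD
      have hTU : {V : Idx k | V.1 ⊆ T.1} ⊆ {U}ᶜ := by
        intro V hV
        rw [mem_compl_singleton_iff]
        rintro rfl
        exact hUT hV
      exact mem_aeAlg (coordAlg_mono hTU D hD)
    rw [inter_comm B C, measure_inter_of_indep hU hC' hB', inter_right_comm,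
      measure_inter_of_indep hU (inter_mem_aeAlg hC' hD') hB',
      (Indep_iff _ _ _).1 ih' C D hC hD]
    ring

/-- The converse inclusion to (3), and the only place where bijectivity is essential to the
independence argument: it makes the pulled-back coordinates generate the full σ-algebra. -/
theorem StructurePreserving.sigmaAlg_le_comap {g : MPBij (Cube k)}
    (hg : StructurePreserving g.1) (T : Idx k) :
    sigmaAlg T ≤ aeAlg ((sigmaAlg T).comap g.1) volume := by
  intro D hD
  have hT : (sigmaAlg T).comap g.1 ≤ aeAlg (sigmaAlg T) volume := by
    rintro _ ⟨A, hA, rfl⟩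
    exact hg.preimage_mem T A hA
  have hind' : ∀ A C, MeasurableSet[aeAlg (sigmaAlg T) volume] A →
      MeasurableSet[(coordAlg {U : Idx k | U.1 ⊆ T.1}ᶜ).comap g.1] C →
      volume (A ∩ C) = volume A * volume C := fun A C hA hC => by
    rw [inter_comm, mul_comm]
    exact measure_inter_of_indep (hg.indep_compl T) (mem_aeAlg hC) hA
  refine measurableSet_aeAlg_of_indep
    (m₂ := (coordAlg {U : Idx k | U.1 ⊆ T.1}ᶜ).comap g.1) ?_ ?_ (sigmaAlg_le T D hD) ?_
  · rw [sigmaAlg_eq, ← MeasurableSpace.comap_sup, ← coordAlg_union, union_compl_self,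
      coordAlg_univ]
    exact g.1.measurableEmbedding.comap_eq
  · rw [Indep_iff]
    exact fun A C hA hC => hind' A C (hT A hA) hC
  · intro B C hB hC
    exact hind' _ C (inter_mem_aeAlg (mem_aeAlg hD) (hT B hB)) hC

/-! ### Stability under null modifications, inverses and products -/

theorem measurePreserving_permCube (τ : Equiv.Perm (Fin k)) :
    MeasurePreserving (permCube τ : Cube k → Cube k) volume volume := by
  let e : Idx k ≃ Idx k :=
    { toFun := permIdx τ
      invFun := permIdx τ.symm
      left_inv := fun S => Subtype.ext (by ext; simp [permIdx])
      right_inv := fun S => Subtype.ext (by ext; simp [permIdx]) }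
  have := volume_measurePreserving_piCongrLeft (fun _ : Idx k => I) e.symm
  convert this using 1
  ext x S
  obtain ⟨S, rfl⟩ := e.symm.surjective S
  rw [MeasurableEquiv.coe_piCongrLeft, Equiv.piCongrLeft_apply_apply]
  exact congrArg (fun U => (x U : ℝ)) (e.apply_symm_apply S)

theorem permCube_permCube (ρ τ : Equiv.Perm (Fin k)) (x : Cube k) :
    permCube ρ (permCube τ x) = permCube (τ * ρ) x := by
  funext S
  exact congrArg x (Subtype.ext (by simp [permIdx, Finset.map_map]; rfl))

theorem StructurePreserving.congr {ψ φ : Cube k → Cube k} (hψ : StructurePreserving ψ)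
    (hφ : Measurable φ) (h : ψ =ᵐ[volume] φ) : StructurePreserving φ where
  measurePreserving := ⟨hφ, by rw [← Measure.map_congr h, hψ.measurePreserving.map_eq]⟩
  comm τ := by
    filter_upwards [hψ.comm τ, h,
      (measurePreserving_permCube τ).quasiMeasurePreserving.ae h] with x h1 h2 h3
    rw [← h2, ← h3, h1]
  preimage_mem S A hA := by
    obtain ⟨B, hB, hAB⟩ := hψ.preimage_mem S A hA
    exact ⟨B, hB, (h.symm.preimage A).trans hAB⟩
  indep S A hA := by
    have := hψ.indep S A hA
    rw [IndepSets_iff] at this ⊢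
    rintro _ B rfl hB
    rw [measure_congr (h.symm.preimage _), measure_congr ((h.symm.preimage _).inter
      (ae_eq_refl B)), this _ B rfl hB]

theorem StructurePreserving.comap_sigmaAlgStar_le {ψ : Cube k → Cube k}
    (hψ : StructurePreserving ψ) (S : Idx k) :
    (sigmaAlgStar S).comap ψ ≤ aeAlg (sigmaAlgStar S) volume := by
  rw [sigmaAlgStar_eq]
  exact hψ.preimage_coord fun U hU V hV => lt_of_le_of_lt hV hU

theorem StructurePreserving.inv {g : MPBij (Cube k)} (hg : StructurePreserving g.1) :
    StructurePreserving (g⁻¹).1 where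
  measurePreserving := (g⁻¹).2
  comm τ := by
    filter_upwards [(g⁻¹).2.quasiMeasurePreserving.ae (hg.comm τ)] with y hy
    change permCube τ (g.1 (g.1.symm y)) = g.1 (permCube τ (g.1.symm y)) at hy
    change permCube τ (g.1.symm y) = g.1.symm (permCube τ y)
    rw [MeasurableEquiv.apply_symm_apply] at hy
    rw [hy, MeasurableEquiv.symm_apply_apply]
  preimage_mem S A hA := by
    obtain ⟨_, ⟨B, hB, rfl⟩, hAB⟩ := hg.sigmaAlg_le_comap S A hA
    refine ⟨B, hB, ?_⟩
    have := (g⁻¹).2.quasiMeasurePreserving.preimage_ae_eq hAB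
    refine this.trans (Eq.eventuallyEq ?_)
    rw [← preimage_comp]
    exact congrArg (· ⁻¹' B) (funext g.1.apply_symm_apply)
  indep S A hA := by
    rw [IndepSets_iff]
    rintro _ B rfl hB
    obtain ⟨E, hE⟩ : ∃ E : Set (Cube k), E = {x | x S ∈ A} := ⟨_, rfl⟩
    have hEm : MeasurableSet E := hE ▸ sigmaAlg_le S _ (measurableSet_sigmaAlg_coord S hA)
    have hBm := sigmaAlgStar_le S B hB
    -- `g⁻¹(B)` is in `𝒜*_S` modulo null sets, hence independent of the `S`-coordinate; applying `g`
    -- transports this to the claim.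
    have i2 : volume (E ∩ g.1 ⁻¹' B) = volume E * volume (g.1 ⁻¹' B) :=
      measure_inter_of_indep (indep_coord_sigmaAlgStar S)
      (mem_aeAlg (hE ▸ measurableSet_coordAlg_coord S hA)) (hg.comap_sigmaAlgStar_le S _ ⟨B, hB, rfl⟩)
    have e1 : E = g.1 ⁻¹' ((g⁻¹).1 ⁻¹' E) := by
      rw [← preimage_comp]
      exact (congrArg (· ⁻¹' E) (funext g.1.symm_apply_apply)).symm
    rw [← hE]
    have hE' := (g⁻¹).1.measurable hEm
    rw [e1, ← preimage_inter, g.2.measure_preimage (hE'.inter hBm).nullMeasurableSet,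
      g.2.measure_preimage hE'.nullMeasurableSet,
      g.2.measure_preimage hBm.nullMeasurableSet] at i2
    exact i2

theorem StructurePreserving.sigmaAlgStar_le_comap {g : MPBij (Cube k)}
    (hg : StructurePreserving g.1) (S : Idx k) :
    sigmaAlgStar S ≤ aeAlg ((sigmaAlgStar S).comap g.1) volume := by
  intro A hA
  obtain ⟨B, hB, hAB⟩ := hg.inv.comap_sigmaAlgStar_le S _ ⟨A, hA, rfl⟩
  refine ⟨g.1 ⁻¹' B, ⟨B, hB, rfl⟩, ?_⟩
  refine EventuallyEq.trans (Eq.eventuallyEq ?_) (g.2.quasiMeasurePreserving.preimage_ae_eq hAB)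
  rw [← preimage_comp]
  exact (congrArg (· ⁻¹' A) (funext g.1.symm_apply_apply)).symm

theorem StructurePreserving.mul {g h : MPBij (Cube k)} (hg : StructurePreserving g.1)
    (hh : StructurePreserving h.1) : StructurePreserving (g * h).1 where
  measurePreserving := (g * h).2
  comm τ := by
    filter_upwards [h.2.quasiMeasurePreserving.ae (hg.comm τ), hh.comm τ] with x h1 h2
    change permCube τ (g.1 (h.1 x)) = g.1 (h.1 (permCube τ x))
    rw [h1, h2]
  preimage_mem S A hA := by
    obtain ⟨B, hB, hAB⟩ := hg.preimage_mem S A hA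
    obtain ⟨C, hC, hBC⟩ := hh.preimage_mem S B hB
    exact ⟨C, hC, (h.2.quasiMeasurePreserving.preimage_ae_eq hAB).trans hBC⟩
  indep S A hA := by
    rw [IndepSets_iff]
    rintro _ B rfl hB
    -- Writing `B` as `h⁻¹(C)` modulo null sets uses that `h⁻¹` is structure preserving; (4) for `g`
    -- and `C` is then pulled back by `h`.
    obtain ⟨_, ⟨C, hC, rfl⟩, hBC⟩ := hh.sigmaAlgStar_le_comap S B hB
    set D : Set (Cube k) := g.1 ⁻¹' {x | x S ∈ A} with hD
    have hDm : MeasurableSet D :=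
      g.1.measurable (sigmaAlg_le S _ (measurableSet_sigmaAlg_coord S hA))
    have hCm := sigmaAlgStar_le S C hC
    change volume (h.1 ⁻¹' D ∩ B) = volume (h.1 ⁻¹' D) * volume B
    rw [measure_congr ((ae_eq_refl _).inter hBC), measure_congr hBC, ← preimage_inter,
      h.2.measure_preimage (hDm.inter hCm).nullMeasurableSet,
      h.2.measure_preimage hDm.nullMeasurableSet,
      h.2.measure_preimage hCm.nullMeasurableSet]
    exact (IndepSets_iff _ _ _).1 (hg.indep S A hA) D C rfl hC

theorem StructurePreserving.one : StructurePreserving (1 : MPBij (Cube k)).1 where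
  measurePreserving := (1 : MPBij (Cube k)).2
  comm _ := Eventually.of_forall fun _ => rfl
  preimage_mem _ A hA := ⟨A, hA, ae_eq_refl _⟩
  indep S A hA := by
    rw [IndepSets_iff]
    rintro _ B rfl hB
    exact (Indep_iff _ _ _).1 (indep_coord_sigmaAlgStar S) _ B
      (measurableSet_coordAlg_coord S hA) hB

end Coord

/-! ### Basic neighbourhoods in the weak topology -/

section Aut

variable {Ω : Type} [MeasureSpace Ω]

theorem MPAut.mk_eq_mk {g h : MPBij Ω} :
    MPAut.mk g = MPAut.mk h ↔ (g.1 : Ω → Ω) =ᵐ[volume] (h.1 : Ω → Ω) :=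
  (aeCon Ω).eq

theorem MPAut.exists_rep (q : MPAut Ω) : ∃ g : MPBij Ω, MPAut.mk g = q :=
  Quotient.exists_rep q

theorem weakDist_mk (A : Set Ω) (g h : MPBij Ω) :
    weakDist A (MPAut.mk g) (MPAut.mk h) =
      volume (symmDiff (g.1.symm ⁻¹' A) (h.1.symm ⁻¹' A)) := by
  rw [← MeasurableEquiv.image_eq_preimage_symm, ← MeasurableEquiv.image_eq_preimage_symm]
  rfl

theorem weakDist_self (A : Set Ω) (q : MPAut Ω) : weakDist A q q = 0 := by
  obtain ⟨g, rfl⟩ := q.exists_rep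
  simp [weakDist_mk]

theorem weakDist_lt_mem_nhds {A : Set Ω} (hA : MeasurableSet A) (q : MPAut Ω) {ε : ℝ≥0∞}
    (hε : 0 < ε) : {q' | weakDist A q q' < ε} ∈ 𝓝 q :=
  IsOpen.mem_nhds (TopologicalSpace.isOpen_generateFrom_of_mem ⟨q, A, ε, hA, hε, rfl⟩)
    (show weakDist A q q < ε by rwa [weakDist_self])

end Aut

/-! ### The subgroup and its closedness -/

section Subgroup

variable (k : ℕ)

/-- The group of classes of structure preserving bijections of the cube. -/
def structureGroup : Subgroup (MPAut (Cube k)) where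
  carrier := {q | ∃ g : MPBij (Cube k), MPAut.mk g = q ∧ StructurePreserving g.1}
  mul_mem' := by
    rintro _ _ ⟨g, rfl, hg⟩ ⟨h, rfl, hh⟩
    exact ⟨g * h, rfl, hg.mul hh⟩
  one_mem' := ⟨1, rfl, StructurePreserving.one⟩
  inv_mem' := by
    rintro _ ⟨g, rfl, hg⟩
    exact ⟨g⁻¹, rfl, hg.inv⟩

variable {k}

theorem mk_mem_structureGroup {g : MPBij (Cube k)} :
    MPAut.mk g ∈ structureGroup k ↔ StructurePreserving g.1 := by
  constructor
  · rintro ⟨h, hgh, hh⟩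
    exact hh.congr g.1.measurable (MPAut.mk_eq_mk.1 hgh)
  · exact fun hg => ⟨g, rfl, hg⟩

/-- Two sets are approximated at once because commutation with `permCube τ` compares the preimages
of `U` and of `permCube τ ⁻¹' U`. -/
theorem exists_near_of_mem_closure {h : MPBij (Cube k)}
    (hh : MPAut.mk h ∈ closure (structureGroup k : Set (MPAut (Cube k)))) {A B : Set (Cube k)}
    (hA : MeasurableSet A) (hB : MeasurableSet B) {ε : ℝ≥0∞} (hε : 0 < ε) :
    ∃ g : MPBij (Cube k), StructurePreserving (g⁻¹).1 ∧
      volume (symmDiff (h.1.symm ⁻¹' A) (g.1.symm ⁻¹' A)) < ε ∧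
      volume (symmDiff (h.1.symm ⁻¹' B) (g.1.symm ⁻¹' B)) < ε := by
  obtain ⟨_, ⟨h1, h2⟩, g, rfl, hg⟩ := mem_closure_iff_nhds.1 hh _
    (inter_mem (weakDist_lt_mem_nhds hA (MPAut.mk h) hε)
      (weakDist_lt_mem_nhds hB (MPAut.mk h) hε))
  exact ⟨g, hg.inv, by rw [← weakDist_mk]; exact h1, by rw [← weakDist_mk]; exact h2⟩

theorem structurePreserving_inv_of_mem_closure {h : MPBij (Cube k)}
    (hh : MPAut.mk h ∈ closure (structureGroup k : Set (MPAut (Cube k)))) :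
    StructurePreserving (h⁻¹).1 where
  measurePreserving := (h⁻¹).2
  comm τ := by
    have hτ := measurePreserving_permCube (k := k) τ
    -- The σ-algebra is countably separated, so it is enough to compare preimages of measurable
    -- sets.
    refine EventuallyEq.of_forall_separating_preimage (f := fun x => permCube τ (h.1.symm x))
      (g := fun x => h.1.symm (permCube τ x)) MeasurableSet fun U hU => ?_
    rw [← measure_symmDiff_eq_zero_iff]
    refine le_antisymm (ENNReal.le_of_forall_pos_le_add fun ε hε _ => ?_) zero_le
    have hε' : (0 : ℝ≥0∞) < ε / 2 := ENNReal.half_pos (by exact_mod_cast hε.ne')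
    obtain ⟨g, hg, h1, h2⟩ := exists_near_of_mem_closure hh (hτ.measurable hU) hU hε'
    have e : (g.1.symm ⁻¹' (permCube τ ⁻¹' U) : Set (Cube k)) =ᵐ[volume]
        (permCube τ ⁻¹' (g.1.symm ⁻¹' U) : Set (Cube k)) :=
      EventuallyEq.preimage (f := fun x => permCube τ (g.1.symm x))
        (g := fun x => g.1.symm (permCube τ x)) (hg.comm τ) U
    have h3 : volume (symmDiff (permCube τ ⁻¹' (g.1.symm ⁻¹' U))
        (permCube τ ⁻¹' (h.1.symm ⁻¹' U))) < ε / 2 := by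
      rw [symmDiff_comm, ← preimage_symmDiff, hτ.measure_preimage
        ((h.1.symm.measurable hU).symmDiff (g.1.symm.measurable hU)).nullMeasurableSet]
      exact h2
    calc volume (symmDiff (h.1.symm ⁻¹' (permCube τ ⁻¹' U))
          (permCube τ ⁻¹' (h.1.symm ⁻¹' U)))
        ≤ volume (symmDiff (h.1.symm ⁻¹' (permCube τ ⁻¹' U)) (g.1.symm ⁻¹' (permCube τ ⁻¹' U))) +
          volume (symmDiff (g.1.symm ⁻¹' (permCube τ ⁻¹' U))
            (permCube τ ⁻¹' (h.1.symm ⁻¹' U))) := measure_symmDiff_le _ _ _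
      _ ≤ ε / 2 + ε / 2 := by
          refine add_le_add h1.le ?_
          exact (measure_congr (e.symmDiff (ae_eq_refl _))).trans_le h3.le
      _ = 0 + ε := by rw [ENNReal.add_halves, zero_add]
  preimage_mem S A hA := by
    have hAm := sigmaAlg_le S A hA
    refine measurableSet_aeAlg_of_forall_lt fun ε hε => ?_
    obtain ⟨g, hg, h1, -⟩ := exists_near_of_mem_closure hh hAm hAm hε
    exact ⟨_, hg.preimage_mem S A hA, h1⟩
  indep S A hA := by
    rw [IndepSets_iff]
    rintro _ B rfl hB
    obtain ⟨E, hE⟩ : ∃ E : Set (Cube k), E = {x | x S ∈ A} := ⟨_, rfl⟩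
    have hEm : MeasurableSet E := hE ▸ sigmaAlg_le S _ (measurableSet_sigmaAlg_coord S hA)
    have hBm := sigmaAlgStar_le S B hB
    rw [← hE, ← ENNReal.toReal_eq_toReal_iff' (measure_ne_top _ _) (by finiteness),
      ENNReal.toReal_mul]
    -- `h⁻¹` and the nearby `g⁻¹` both preserve measure, so the product side is the same for both;
    -- only the intersection changes, by at most the symmetric difference.
    refine eq_of_forall_dist_le fun ε hε => ?_
    obtain ⟨g, hg, h1, -⟩ := exists_near_of_mem_closure hh hEm hEm (ENNReal.ofReal_pos.2 hε)
    have e1 : volume (h.1.symm ⁻¹' E) = volume (g.1.symm ⁻¹' E) :=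
      ((h⁻¹).2.measure_preimage hEm.nullMeasurableSet).trans
        ((g⁻¹).2.measure_preimage hEm.nullMeasurableSet).symm
    have e2 : volume (g.1.symm ⁻¹' E ∩ B) = volume (g.1.symm ⁻¹' E) * volume B := by
      rw [hE]
      exact (IndepSets_iff _ _ _).1 (hg.indep S A hA) _ B rfl hB
    have e3 : (volume (h.1.symm ⁻¹' E)).toReal * (volume B).toReal =
        volume.real (g.1.symm ⁻¹' E ∩ B) := by
      rw [measureReal_def, e2, e1, ENNReal.toReal_mul]
    change dist (volume.real (h.1.symm ⁻¹' E ∩ B))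
      ((volume (h.1.symm ⁻¹' E)).toReal * (volume B).toReal) ≤ ε
    rw [e3, Real.dist_eq]
    refine (abs_measureReal_sub_le_measureReal_symmDiff
      ((h.1.symm.measurable hEm).inter hBm).nullMeasurableSet
      ((g.1.symm.measurable hEm).inter hBm).nullMeasurableSet).trans ?_
    refine ENNReal.toReal_le_of_le_ofReal hε.le ((measure_mono ?_).trans h1.le)
    rintro x (⟨⟨hx, hxB⟩, hx'⟩ | ⟨⟨hx, hxB⟩, hx'⟩)
    · exact Or.inl ⟨hx, fun h => hx' ⟨h, hxB⟩⟩
    · exact Or.inr ⟨hx, fun h => hx' ⟨h, hxB⟩⟩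

theorem isClosed_structureGroup : IsClosed (structureGroup k : Set (MPAut (Cube k))) := by
  refine isClosed_of_closure_subset fun q hq => ?_
  obtain ⟨h, rfl⟩ := q.exists_rep
  have := (structureGroup k).inv_mem
    (mk_mem_structureGroup.2 (structurePreserving_inv_of_mem_closure hq))
  exact this

end Subgroup

/-! ### The action on hypergraphons and its continuity -/

section Action

variable {k : ℕ}

theorem edist_hypergraphon (U W : Hypergraphon k) :
    edist U W = volume (symmDiff U.carrier W.carrier) := by
  change edist (indicatorConstLp 1 U.measurableSet (measure_ne_top volume U.carrier) (1 : ℝ))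
    (indicatorConstLp 1 W.measurableSet (measure_ne_top volume W.carrier) (1 : ℝ)) = _
  rw [edist_indicatorConstLp_eq_enorm, ← ofReal_norm,
    norm_indicatorConstLp one_ne_zero ENNReal.one_ne_top]
  simp

theorem mk_eq_mk_iff {U W : Hypergraphon k} :
    (SeparationQuotient.mk U : HypergraphonSpace k) = SeparationQuotient.mk W ↔
      U.carrier =ᵐ[volume] W.carrier := by
  rw [SeparationQuotient.mk_eq_mk, EMetric.inseparable_iff, edist_hypergraphon,
    measure_symmDiff_eq_zero_iff]

/-- The image of a hypergraphon, symmetrized on a null set. -/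
def imageHypergraphon (g : MPBij (Cube k)) (W : Hypergraphon k) : Hypergraphon k where
  carrier := ⋂ τ : Equiv.Perm (Fin k), permCube τ ⁻¹' (g.1.symm ⁻¹' W.carrier)
  measurableSet := MeasurableSet.iInter fun τ =>
    (measurePreserving_permCube τ).measurable (g.1.symm.measurable W.measurableSet)
  symmetric ρ := by
    ext x
    simp only [mem_preimage, mem_iInter, permCube_permCube]
    exact ⟨fun h τ => by simpa using h (ρ⁻¹ * τ), fun h τ => h (ρ * τ)⟩

/-- Off one null set, `g⁻¹` commutes with all of the finitely many `permCube τ`; as `W` is strictly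
invariant, all the intersected conditions coincide there. -/
theorem imageHypergraphon_ae_eq {g : MPBij (Cube k)} (hg : StructurePreserving g.1)
    (W : Hypergraphon k) :
    (imageHypergraphon g W).carrier =ᵐ[volume] (g.1.symm ⁻¹' W.carrier : Set (Cube k)) := by
  have h : ∀ᵐ x, ∀ τ : Equiv.Perm (Fin k),
      permCube τ (g.1.symm x) = g.1.symm (permCube τ x) := ae_all_iff.2 hg.inv.comm
  refine eventuallyEq_set.2 ?_
  filter_upwards [h] with x hx
  have hW : ∀ τ : Equiv.Perm (Fin k), permCube τ (g.1.symm x) ∈ W.carrier ↔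
      g.1.symm x ∈ W.carrier := fun τ => by
    rw [← mem_preimage, W.symmetric τ]
  simp only [imageHypergraphon, mem_iInter, mem_preimage, ← hx, hW, forall_const]

theorem structureGroup.exists_rep (q : structureGroup k) :
    ∃ g : MPBij (Cube k), MPAut.mk g = q.1 ∧ StructurePreserving g.1 := q.2

theorem structureGroup.exists_eq_mk (q : structureGroup k) :
    ∃ (g : MPBij (Cube k)) (hg : MPAut.mk g ∈ structureGroup k), q = ⟨MPAut.mk g, hg⟩ := by
  obtain ⟨q, hq⟩ := q
  obtain ⟨g, rfl⟩ := q.exists_rep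
  exact ⟨g, hq, rfl⟩

/-- The action of a class of structure preserving bijections on a class of hypergraphons. -/
noncomputable def actClass (q : structureGroup k) (w : HypergraphonSpace k) : HypergraphonSpace k :=
  SeparationQuotient.mk (imageHypergraphon (structureGroup.exists_rep q).choose
    (SeparationQuotient.surjective_mk w).choose)

/-- Shows that the representatives chosen in `actClass` do not matter; the action laws reduce to
this. -/
theorem actClass_eq_mk_iff (g : MPBij (Cube k)) (hg : MPAut.mk g ∈ structureGroup k)
    (W V : Hypergraphon k) :
    actClass ⟨MPAut.mk g, hg⟩ (SeparationQuotient.mk W) = SeparationQuotient.mk V ↔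
      V.carrier =ᵐ[volume] {x | g.1.symm x ∈ W.carrier} := by
  obtain ⟨h1, h2⟩ := (structureGroup.exists_rep ⟨MPAut.mk g, hg⟩).choose_spec
  have hW := (SeparationQuotient.surjective_mk
    (SeparationQuotient.mk W : HypergraphonSpace k)).choose_spec
  rw [actClass, mk_eq_mk_iff]
  set g' := (structureGroup.exists_rep ⟨MPAut.mk g, hg⟩).choose
  set W' := (SeparationQuotient.surjective_mk
    (SeparationQuotient.mk W : HypergraphonSpace k)).choose
  have e1 := image_ae_eq (MPAut.mk_eq_mk.1 h1) W'.carrier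
  rw [MeasurableEquiv.image_eq_preimage_symm, MeasurableEquiv.image_eq_preimage_symm] at e1
  have e2 := (g⁻¹).2.quasiMeasurePreserving.preimage_ae_eq (mk_eq_mk_iff.1 hW)
  have e := ((imageHypergraphon_ae_eq h2 W').trans e1).trans e2
  exact ⟨fun h => h.symm.trans e, fun h => e.trans h.symm⟩

theorem actClass_mk_mk (g : MPBij (Cube k)) (hg : MPAut.mk g ∈ structureGroup k)
    (W : Hypergraphon k) :
    actClass ⟨MPAut.mk g, hg⟩ (SeparationQuotient.mk W) =
      SeparationQuotient.mk (imageHypergraphon g W) :=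
  (actClass_eq_mk_iff g hg W _).2 (imageHypergraphon_ae_eq (mk_mem_structureGroup.1 hg) W)

/-- The action of the structure group on the space of hypergraphons. -/
noncomputable abbrev hypergraphonAction (k : ℕ) :
    MulAction (structureGroup k) (HypergraphonSpace k) where
  smul := actClass
  one_smul w := by
    obtain ⟨W, rfl⟩ := SeparationQuotient.surjective_mk w
    exact (actClass_eq_mk_iff 1 (structureGroup k).one_mem W W).2 (ae_eq_refl _)
  mul_smul p q w := by
    obtain ⟨g, hg, rfl⟩ := structureGroup.exists_eq_mk p
    obtain ⟨h, hh, rfl⟩ := structureGroup.exists_eq_mk q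
    obtain ⟨W, rfl⟩ := SeparationQuotient.surjective_mk w
    change actClass _ _ = actClass _ (actClass _ _)
    rw [actClass_mk_mk, actClass_mk_mk]
    refine (actClass_eq_mk_iff (g * h) ((structureGroup k).mul_mem hg hh) W _).2 ?_
    exact (imageHypergraphon_ae_eq (mk_mem_structureGroup.1 hg) _).trans
      ((g⁻¹).2.quasiMeasurePreserving.preimage_ae_eq
        (imageHypergraphon_ae_eq (mk_mem_structureGroup.1 hh) W))

/-- Triangle inequality through `hW`: the first term is `d₁(hV, hW) = d₁(V, W)`, as `h` preserves
measure, and the second is a weak-topology distance for the fixed set `W`. -/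
theorem edist_actClass_le (p q : structureGroup k) (W V : Hypergraphon k) :
    edist (actClass q (SeparationQuotient.mk V)) (actClass p (SeparationQuotient.mk W)) ≤
      edist (SeparationQuotient.mk V : HypergraphonSpace k) (SeparationQuotient.mk W) +
        weakDist W.carrier p.1 q.1 := by
  obtain ⟨g, hg, rfl⟩ := structureGroup.exists_eq_mk p
  obtain ⟨h, hh, rfl⟩ := structureGroup.exists_eq_mk q
  have hg' := mk_mem_structureGroup.1 hg
  have hh' := mk_mem_structureGroup.1 hh
  rw [actClass_mk_mk, actClass_mk_mk, SeparationQuotient.edist_mk, SeparationQuotient.edist_mk,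
    edist_hypergraphon, edist_hypergraphon, weakDist_mk,
    measure_congr ((imageHypergraphon_ae_eq hh' V).symmDiff (imageHypergraphon_ae_eq hg' W))]
  refine (measure_symmDiff_le _ (h.1.symm ⁻¹' W.carrier) _).trans (add_le_add ?_ ?_)
  · rw [← preimage_symmDiff]
    exact ((h⁻¹).2.measure_preimage
      (V.measurableSet.symmDiff W.measurableSet).nullMeasurableSet).le
  · rw [symmDiff_comm]

theorem continuous_actClass :
    Continuous fun p : structureGroup k × HypergraphonSpace k => actClass p.1 p.2 := by
  rw [continuous_iff_continuousAt]
  rintro ⟨q, w⟩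
  obtain ⟨W, rfl⟩ := SeparationQuotient.surjective_mk w
  refine EMetric.tendsto_nhds.2 fun ε hε => ?_
  have hε' : 0 < ε / 2 := ENNReal.half_pos hε.ne'
  have h1 : ∀ᶠ p in 𝓝 q, weakDist W.carrier q.1 p.1 < ε / 2 :=
    continuous_subtype_val.continuousAt.eventually
      (weakDist_lt_mem_nhds W.measurableSet q.1 hε')
  have h2 : ∀ᶠ v in 𝓝 (SeparationQuotient.mk W : HypergraphonSpace k),
      edist v (SeparationQuotient.mk W) < ε / 2 := Metric.eball_mem_nhds _ hε'
  filter_upwards [h1.prod_nhds h2]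
  rintro ⟨p, v⟩ ⟨hp, hv⟩
  obtain ⟨V, rfl⟩ := SeparationQuotient.surjective_mk v
  exact (edist_actClass_le q p W V).trans_lt
    ((ENNReal.add_lt_add hv hp).trans_eq (ENNReal.add_halves ε))

end Action

end KHypergraphon

theorem mainTheorem7 (k : ℕ) :
    ∃ G : Subgroup (KHypergraphon.MPAut (KHypergraphon.Cube k)),
      (∀ g : KHypergraphon.MPBij (KHypergraphon.Cube k),
        KHypergraphon.MPAut.mk g ∈ G ↔ KHypergraphon.StructurePreserving g.1) ∧
      IsClosed (G : Set (KHypergraphon.MPAut (KHypergraphon.Cube k))) ∧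
      ∃ act : MulAction G (KHypergraphon.HypergraphonSpace k),
        (∀ (g : KHypergraphon.MPBij (KHypergraphon.Cube k)) (hg : KHypergraphon.MPAut.mk g ∈ G)
          (W V : KHypergraphon.Hypergraphon k),
          act.smul ⟨KHypergraphon.MPAut.mk g, hg⟩ (SeparationQuotient.mk W) =
              SeparationQuotient.mk V ↔
            V.carrier =ᵐ[volume] {x | g.1.symm x ∈ W.carrier}) ∧
        Continuous (fun p : G × KHypergraphon.HypergraphonSpace k => act.smul p.1 p.2) := by
  exact ⟨KHypergraphon.structureGroup k, fun _ => KHypergraphon.mk_mem_structureGroup,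
    KHypergraphon.isClosed_structureGroup, KHypergraphon.hypergraphonAction k,
    KHypergraphon.actClass_eq_mk_iff, KHypergraphon.continuous_actClass⟩
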